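/- For complex numbers $a,b,c,d$ with positive real parts and $x>0$ put $$K(a,b,c,d)=\frac{\Gamma(a+b+c+d)}{4\pi\,\Gamma(a+b)\Gamma(a+c)\Gamma(b+c)\Gamma(a+d)\Gamma(b+d)\Gamma(c+d)},$$ $$f(x;a,b,c,d)=K(a,b,c,d)\,\frac{\left|\Gamma(a+i\sqrt x)\Gamma(b+i\sqrt x)\Gamma(c+i\sqrt x)\Gamma(d+i\sqrt x)\right|^2}{\sqrt x\,\left|\Gamma(2i\sqrt x)\right|^2}.$$ Let $m>0$. Suppose that $a,b$ are either two positive real numbers or a complex conjugate pair with positive real part, and likewise that $c,d$ are either two positive real numbers or a complex conjugate pair with positive real part. Then: (i) for every $y>0$ the integral below converges absolutely and $$f(y;a,b,c+m,d+m)=\int_0^\infty f\left(y;a,b,m+i\sqrt x,m-i\sqrt x\right)f(x;a+m,b+m,c,d)\,dx;$$ (ii) for all $x,y>0$ one has $f(y;a,b,c+m,d+m)\neq 0$ and $$\frac{f(x;a+m,b+m,c,d)\,f\left(y;a,b,m+i\sqrt x,m-i\sqrt x\right)}{f(y;a,b,c+m,d+m)}=f\left(x;m+i\sqrt y,m-i\sqrt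 y,c,d\right).$$ -/

import Mathlib

/-- The normalizing constant `K(a, b, c, d)` of the four-parameter (de Branges-Wilson) beta
integral. -/
noncomputable def wilsonK (a b c d : ℂ) : ℂ :=
  Complex.Gamma (a + b + c + d) /
    (4 * (Real.pi : ℂ) * Complex.Gamma (a + b) * Complex.Gamma (a + c) * Complex.Gamma (b + c) *
      Complex.Gamma (a + d) * Complex.Gamma (b + d) * Complex.Gamma (c + d))

/-- Wilson's density `f(x; a, b, c, d)`, meant for `x > 0`. It is written as a complex number
because `K(a, b, c, d)` is built from complex Gamma values; it is a positive real number when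
`a, b, c, d` are positive reals, or come as one or two conjugate pairs with positive real parts. -/
noncomputable def wilsonDensity (x : ℝ) (a b c d : ℂ) : ℂ :=
  wilsonK a b c d *
    ((‖Complex.Gamma (a + Complex.I * (√x : ℝ)) * Complex.Gamma (b + Complex.I * (√x : ℝ)) *
        Complex.Gamma (c + Complex.I * (√x : ℝ)) * Complex.Gamma (d + Complex.I * (√x : ℝ))‖ ^ 2 /
      (√x * ‖Complex.Gamma (2 * Complex.I * (√x : ℝ))‖ ^ 2) : ℝ) : ℂ)

/-- `p` and `q` are two positive reals, or two complex conjugate numbers with positive real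
part. -/
def IsAdmissiblePair (p q : ℂ) : Prop :=
  0 < p.re ∧ 0 < q.re ∧ ((p.im = 0 ∧ q.im = 0) ∨ q = (starRingEnd ℂ) p)

/-!
The two parts of the theorem are linked by a symmetry. For admissible pairs the absolute values in
Wilson's density are products of Gamma functions, and after cancellation both sides of the
rearrangement identity consist of the same Gamma factors (`wilsonDensity_mul_wilsonDensity`). Hence
the integrand of the convolution formula equals `f(y; a, b, c + m, d + m)` times
`f(x; m + i√y, m - i√y, c, d)`, and the formula says that the latter density has total mass one.

That is the de Branges–Wilson integral (`integral_Ioi_wilsonWeight`), which is proved for arbitrary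
parameters with positive real part. Substituting `x = s²` and using
`1 / |Γ(2is)|² = 2 s sinh (2πs) / π`, one has to evaluate
`W(a, b, c, d) = ∫ Γ(a ± is) Γ(b ± is) Γ(c ± is) Γ(d ± is) s sinh (2πs) ds` over the real line.

* Shifting a contour across the strip `|re z| ≤ 1/2` gives the recurrence
  `(a + b + c + d) W(a + 1, b, c, d) = (a + b) (a + c) (a + d) W(a, b, c, d)`
  (`add_mul_integral_wilsonWeight_add_one`). So the quotient of `W` by its expected value is
  `1`-periodic in each parameter.
* Along `a, a + 1, a + 2, …` this quotient converges, by the Euler limit for the Gamma function and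
  dominated convergence, to an expression without `a` (`wilsonRatio_eq_dualHahn`). Being symmetric,
  it is then a constant (`wilsonRatio_eq_wilsonRatio`).
* At the parameters `1/2, 1, 1/2, 1` the integrand is a multiple of `s³ / sinh (2πs)`, whose integral
  comes from `∑ 1 / (2k + 1)⁴ = π⁴ / 96` (`integral_wilsonWeight_special`).

The convergence statements rest on the decay of `Γ` in vertical strips
(`exists_norm_Gamma_strip_le`). It is explicit on the lines `re z = N + 1/2`, and spreads to the left
because `‖Γ(z)‖ / Γ(re z)` increases with `re z` (`Complex.norm_Gamma_mul_Gamma_le`).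
-/

open MeasureTheory Filter Topology

/-! ### Exponential decay of the Gamma function on vertical strips -/

lemma Complex.norm_Gamma_le_Gamma_re {z : ℂ} (hz : 0 < z.re) :
    ‖Complex.Gamma z‖ ≤ Real.Gamma z.re := by
  rw [Complex.Gamma_eq_integral hz, Real.Gamma_eq_integral hz, Complex.GammaIntegral]
  refine (norm_integral_le_integral_norm _).trans (le_of_eq ?_)
  refine setIntegral_congr_fun measurableSet_Ioi fun x hx => ?_
  rw [Set.mem_Ioi] at hx
  simp [Complex.norm_cpow_eq_rpow_re_of_pos hx, Complex.norm_exp]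

/-- For fixed imaginary part, `‖Γ(z)‖ / Γ(re z)` increases with the real part of `z`: the beta
integral `Γ(z) Γ(δ) / Γ(z + δ)` is dominated by its value at `re z`. -/
lemma Complex.norm_Gamma_mul_Gamma_le {z : ℂ} (hz : 0 < z.re) {δ : ℝ} (hδ : 0 < δ) :
    ‖Complex.Gamma z‖ * Real.Gamma (z.re + δ) ≤ Real.Gamma z.re * ‖Complex.Gamma (z + δ)‖ := by
  have hB : ‖Complex.betaIntegral z δ‖ ≤ ‖Complex.betaIntegral (z.re : ℂ) δ‖ := by
    have e : Complex.betaIntegral (z.re : ℂ) δ =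
        ((∫ x : ℝ in (0:ℝ)..1, x ^ (z.re - 1) * (1 - x) ^ (δ - 1) : ℝ) : ℂ) := by
      rw [Complex.betaIntegral, ← intervalIntegral.integral_ofReal]
      refine intervalIntegral.integral_congr fun x hx => ?_
      rw [Set.uIcc_of_le zero_le_one] at hx
      have h1 : (0 : ℝ) ≤ 1 - x := by linarith [hx.2]
      push_cast [Complex.ofReal_cpow hx.1, Complex.ofReal_cpow h1]
      rfl
    rw [e, Complex.norm_real]
    refine le_trans ?_ (le_abs_self _)
    rw [Complex.betaIntegral]
    refine (intervalIntegral.norm_integral_le_integral_norm zero_le_one).trans (le_of_eq ?_)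
    rw [intervalIntegral.integral_of_le zero_le_one, intervalIntegral.integral_of_le zero_le_one,
      integral_Ioc_eq_integral_Ioo, integral_Ioc_eq_integral_Ioo]
    refine setIntegral_congr_fun measurableSet_Ioo fun x hx => ?_
    have h1 : (0 : ℝ) < 1 - x := by linarith [hx.2]
    have h2 : (1 : ℂ) - x = ((1 - x : ℝ) : ℂ) := by push_cast; rfl
    simp only [norm_mul]
    rw [h2, Complex.norm_cpow_eq_rpow_re_of_pos hx.1, Complex.norm_cpow_eq_rpow_re_of_pos h1]
    simp
  have hδ' : 0 < (δ : ℂ).re := by simpa using hδ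
  have hz' : 0 < ((z.re : ℝ) : ℂ).re := by simpa using hz
  have h1 := congrArg norm (Complex.Gamma_mul_Gamma_eq_betaIntegral hz hδ')
  have h2 := congrArg norm (Complex.Gamma_mul_Gamma_eq_betaIntegral hz' hδ')
  rw [← Complex.ofReal_add] at h2
  simp only [norm_mul, Complex.Gamma_ofReal, Complex.norm_real, Real.norm_eq_abs,
    abs_of_pos (Real.Gamma_pos_of_pos hz), abs_of_pos (Real.Gamma_pos_of_pos hδ),
    abs_of_pos (Real.Gamma_pos_of_pos (add_pos hz hδ))] at h1 h2
  have hd := Real.Gamma_pos_of_pos hδ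
  refine le_of_mul_le_mul_right ?_ hd
  calc ‖Complex.Gamma z‖ * Real.Gamma (z.re + δ) * Real.Gamma δ
      = (‖Complex.Gamma z‖ * Real.Gamma δ) * Real.Gamma (z.re + δ) := by ring
    _ = ‖Complex.Gamma (z + δ)‖ * (Real.Gamma (z.re + δ) * ‖Complex.betaIntegral z δ‖) := by
        rw [h1]; ring
    _ ≤ ‖Complex.Gamma (z + δ)‖ *
        (Real.Gamma (z.re + δ) * ‖Complex.betaIntegral (z.re : ℂ) δ‖) := by
        have := (Real.Gamma_pos_of_pos (add_pos hz hδ)).le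
        gcongr
    _ = _ := by rw [← h2]; ring

/-- The values on the lines `re z = N + 1 / 2` come from `‖Γ(1/2 + iτ)‖² = π / cosh (π τ)` and the
functional equation. -/
lemma exists_norm_Gamma_half_le (N : ℕ) : ∀ φ : ℝ, φ < Real.pi / 2 → ∃ C : ℝ, 0 ≤ C ∧ ∀ τ : ℝ,
    ‖Complex.Gamma (N + 1 / 2 + τ * Complex.I)‖ ≤ C * Real.exp (-φ * |τ|) := by
  induction N with
  | zero =>
    intro φ hφ
    refine ⟨Real.sqrt (2 * Real.pi), Real.sqrt_nonneg _, fun τ => ?_⟩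
    have h := Complex.Gamma_mul_Gamma_one_sub (1 / 2 + τ * Complex.I)
    have e1 : (1 : ℂ) - (1 / 2 + τ * Complex.I) = (starRingEnd ℂ) (1 / 2 + τ * Complex.I) := by
      apply Complex.ext <;> simp; norm_num
    have e2 : Complex.sin (Real.pi * (1 / 2 + τ * Complex.I)) = (Real.cosh (Real.pi * τ) : ℂ) := by
      rw [show (Real.pi * (1 / 2 + τ * Complex.I) : ℂ) =
        (Real.pi * τ : ℂ) * Complex.I + Real.pi / 2 by ring, Complex.sin_add_pi_div_two,
        Complex.cos_mul_I]
      push_cast; rfl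
    rw [e1, Complex.Gamma_conj, Complex.mul_conj, e2] at h
    norm_cast at h
    rw [Complex.normSq_eq_norm_sq] at h
    have hc : Real.exp (2 * φ * |τ|) / 2 ≤ Real.cosh (Real.pi * τ) := by
      rw [← Real.cosh_abs, Real.cosh_eq, abs_mul, abs_of_pos Real.pi_pos]
      have : Real.exp (2 * φ * |τ|) ≤ Real.exp (Real.pi * |τ|) := by
        apply Real.exp_le_exp.2
        have := abs_nonneg τ
        nlinarith
      have := Real.exp_pos (-(Real.pi * |τ|))
      linarith
    have hE := Real.exp_pos (2 * φ * |τ|)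
    have hle : ‖Complex.Gamma ((0 : ℕ) + 1 / 2 + τ * Complex.I)‖ ^ 2 ≤
        (Real.sqrt (2 * Real.pi) * Real.exp (-φ * |τ|)) ^ 2 := by
      rw [Nat.cast_zero, zero_add, mul_pow, Real.sq_sqrt (by positivity), ← Real.exp_nat_mul]
      rw [show ((2 : ℕ) : ℝ) * (-φ * |τ|) = -(2 * φ * |τ|) by push_cast; ring, Real.exp_neg]
      have hh : ‖Complex.Gamma (1 / 2 + τ * Complex.I)‖ ^ 2 = Real.pi / Real.cosh (Real.pi * τ) := by
        rw [← h]
      rw [hh, ← div_eq_mul_inv, div_le_div_iff₀ (Real.cosh_pos _) hE]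
      nlinarith [Real.pi_pos]
    exact le_of_sq_le_sq hle (by positivity)
  | succ N ih =>
    intro φ hφ
    obtain ⟨ψ, h1, h2⟩ := exists_between hφ
    obtain ⟨C, hC, h⟩ := ih ψ h2
    have hd : 0 < ψ - φ := sub_pos.2 h1
    refine ⟨C * (N + 1 / 2 + 1 / (ψ - φ)), by positivity, fun τ => ?_⟩
    have hne : (N + 1 / 2 + τ * Complex.I : ℂ) ≠ 0 := by
      intro h0
      have := congrArg Complex.re h0
      simp at this
      have h3 : (0 : ℝ) ≤ N := Nat.cast_nonneg N
      linarith
    rw [show (((N + 1 : ℕ) : ℂ) + 1 / 2 + τ * Complex.I) = (N + 1 / 2 + τ * Complex.I) + 1 by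
      push_cast; ring, Complex.Gamma_add_one _ hne, norm_mul]
    have h4 : ‖(N + 1 / 2 + τ * Complex.I : ℂ)‖ ≤ N + 1 / 2 + |τ| := by
      refine (norm_add_le _ _).trans ?_
      gcongr
      · refine (norm_add_le _ _).trans (by simp)
      · simp
    have h5 : (N + 1 / 2 + |τ| : ℝ) ≤
        (N + 1 / 2 + 1 / (ψ - φ)) * Real.exp ((ψ - φ) * |τ|) := by
      have h6 := Real.add_one_le_exp ((ψ - φ) * |τ|)
      have h7 : (1 : ℝ) ≤ Real.exp ((ψ - φ) * |τ|) := Real.one_le_exp (by positivity)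
      have h8 : |τ| ≤ 1 / (ψ - φ) * Real.exp ((ψ - φ) * |τ|) := by
        rw [div_mul_eq_mul_div, le_div_iff₀ hd]; linarith
      have h3 : (0 : ℝ) ≤ N + 1 / 2 := by positivity
      nlinarith
    calc _ ≤ ((N + 1 / 2 + 1 / (ψ - φ)) * Real.exp ((ψ - φ) * |τ|)) *
          (C * Real.exp (-ψ * |τ|)) := by
          gcongr
          exacts [h4.trans h5, h τ]
      _ = C * (N + 1 / 2 + 1 / (ψ - φ)) * (Real.exp ((ψ - φ) * |τ|) * Real.exp (-ψ * |τ|)) := by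
          ring
      _ = _ := by rw [← Real.exp_add]; ring_nf

lemma exists_norm_Gamma_strip_le {α : ℝ} (hα : 0 < α) (β : ℝ) {φ : ℝ} (hφ : φ < Real.pi / 2) :
    ∃ C : ℝ, 0 ≤ C ∧ ∀ z : ℂ, α ≤ z.re → z.re ≤ β →
      ‖Complex.Gamma z‖ ≤ C * Real.exp (-φ * |z.im|) := by
  obtain ⟨N, hN⟩ := exists_nat_gt β
  obtain ⟨C, hC, h⟩ := exists_norm_Gamma_half_le N φ hφ
  have hcont : ContinuousOn (fun x : ℝ => Real.Gamma x / Real.Gamma (N + 1 / 2)) (Set.Icc α β) := by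
    refine ContinuousOn.div_const (fun x hx => ?_) _
    refine (Real.differentiableAt_Gamma fun m hm => ?_).continuousAt.continuousWithinAt
    have h3 : (0 : ℝ) ≤ m := Nat.cast_nonneg m
    linarith [hx.1]
  obtain ⟨M, hM⟩ := isCompact_Icc.bddAbove_image hcont
  have hG : 0 < Real.Gamma ((N : ℝ) + 1 / 2) := Real.Gamma_pos_of_pos (by positivity)
  refine ⟨max M 0 * C, by positivity, fun z h1 h2 => ?_⟩
  have hz : 0 < z.re := hα.trans_le h1
  have hδ : 0 < (N : ℝ) + 1 / 2 - z.re := by linarith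
  have h3 := Complex.norm_Gamma_mul_Gamma_le hz hδ
  have e : z + ((N + 1 / 2 - z.re : ℝ) : ℂ) = N + 1 / 2 + z.im * Complex.I := by
    apply Complex.ext <;> simp
  rw [e, show z.re + ((N : ℝ) + 1 / 2 - z.re) = N + 1 / 2 by ring] at h3
  have h4 : Real.Gamma z.re / Real.Gamma (N + 1 / 2) ≤ max M 0 :=
    (hM ⟨z.re, ⟨h1, h2⟩, rfl⟩).trans (le_max_left _ _)
  have h5 : ‖Complex.Gamma z‖ ≤ Real.Gamma z.re / Real.Gamma (N + 1 / 2) *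
      ‖Complex.Gamma (N + 1 / 2 + z.im * Complex.I)‖ := by
    rw [div_mul_eq_mul_div, le_div_iff₀ hG]; exact h3
  calc _ ≤ _ := h5
    _ ≤ max M 0 * (C * Real.exp (-φ * |z.im|)) := by
      gcongr
      exact h _
    _ = _ := by ring

/-! ### Integrals of exponentially decaying functions -/

lemma integrable_exp_neg_abs : Integrable (fun s : ℝ => Real.exp (-|s|)) := by
  refine (integrable_inv_one_add_sq.const_mul 2).mono' (by fun_prop) (ae_of_all _ fun s => ?_)
  rw [Real.norm_eq_abs, abs_of_pos (Real.exp_pos _), Real.exp_neg, ← div_eq_mul_inv,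
    inv_le_comm₀ (Real.exp_pos _) (by positivity), inv_div]
  have h := Real.quadratic_le_exp_of_nonneg (abs_nonneg s)
  rw [sq_abs] at h
  have := abs_nonneg s
  linarith

lemma integrable_of_norm_le_exp_neg_abs {f : ℝ → ℂ} (hf : Continuous f) {C : ℝ}
    (h : ∀ s, ‖f s‖ ≤ C * Real.exp (-|s|)) : Integrable f :=
  (integrable_exp_neg_abs.const_mul C).mono' hf.aestronglyMeasurable (ae_of_all _ h)

/-- Integrals over two vertical lines agree for a function that is holomorphic and exponentially
decaying on the closed strip between them. -/
lemma integral_vertical_eq_integral_vertical {f : ℂ → ℂ} {l u C : ℝ} (hlu : l ≤ u)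
    (hf : DifferentiableOn ℂ f {z | l ≤ z.re ∧ z.re ≤ u})
    (hb : ∀ z : ℂ, l ≤ z.re → z.re ≤ u → ‖f z‖ ≤ C * Real.exp (-|z.im|)) :
    ∫ s : ℝ, f (l + s * Complex.I) = ∫ s : ℝ, f (u + s * Complex.I) := by
  have hint : ∀ x : ℝ, l ≤ x → x ≤ u → Integrable (fun s : ℝ => f (x + s * Complex.I)) := by
    intro x h1 h2
    refine integrable_of_norm_le_exp_neg_abs (C := C) ?_ fun s => ?_
    · rw [← continuousOn_univ]
      refine hf.continuousOn.comp (by fun_prop) fun s _ => ?_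
      simpa using ⟨h1, h2⟩
    · simpa using hb (x + s * Complex.I) (by simpa using h1) (by simpa using h2)
  have hlim : ∀ x : ℝ, l ≤ x → x ≤ u → Tendsto (fun T : ℝ => ∫ s in (-T)..T, f (x + s * Complex.I))
      atTop (𝓝 (∫ s : ℝ, f (x + s * Complex.I))) := fun x h1 h2 =>
    intervalIntegral_tendsto_integral (hint x h1 h2) tendsto_neg_atTop_atBot tendsto_id
  -- The two horizontal sides of the rectangle of height `2T` contribute at most this much.
  have hexp : Tendsto (fun T : ℝ => C * Real.exp (-|T|) * |u - l|) atTop (𝓝 0) := by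
    have h1 : Tendsto (fun T : ℝ => Real.exp (-|T|)) atTop (𝓝 0) :=
      Real.tendsto_exp_atBot.comp (tendsto_neg_atTop_atBot.comp tendsto_abs_atTop_atTop)
    simpa using (h1.const_mul C).mul_const |u - l|
  have hhor : ∀ σ : ℝ → ℝ, (∀ T, |σ T| = |T|) →
      Tendsto (fun T : ℝ => ∫ x in l..u, f (x + (σ T : ℝ) * Complex.I)) atTop (𝓝 0) := by
    intro σ hσ
    refine squeeze_zero_norm (fun T => ?_) hexp
    refine intervalIntegral.norm_integral_le_of_norm_le_const fun x hx => ?_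
    rw [Set.uIoc_of_le hlu] at hx
    simpa [hσ] using hb (x + (σ T : ℝ) * Complex.I) (by simpa using hx.1.le) (by simpa using hx.2)
  have hrect : ∀ T : ℝ, (∫ x in l..u, f (x + ((-T : ℝ) : ℂ) * Complex.I)) -
      (∫ x in l..u, f (x + (T : ℝ) * Complex.I)) +
      Complex.I • (∫ s in (-T)..T, f (u + s * Complex.I)) -
      Complex.I • (∫ s in (-T)..T, f (l + s * Complex.I)) = 0 := by
    intro T
    have h := Complex.integral_boundary_rect_eq_zero_of_differentiableOn f ⟨l, -T⟩ ⟨u, T⟩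
      (hf.mono fun z hz => ?_)
    · simpa using h
    · have := hz.1
      simp only [Set.mem_preimage, Set.uIcc_of_le hlu, Set.mem_Icc] at this
      exact this
  have hlimit := (((hhor (fun T => -T) (fun T => abs_neg T)).sub (hhor id (fun T => rfl))).add
    ((hlim u hlu le_rfl).const_smul Complex.I)).sub ((hlim l le_rfl hlu).const_smul Complex.I)
  have h0 := tendsto_nhds_unique (hlimit.congr hrect) tendsto_const_nhds
  rw [sub_zero, zero_add, ← smul_sub, smul_eq_mul, mul_eq_zero] at h0
  exact (sub_eq_zero.1 (h0.resolve_left Complex.I_ne_zero)).symm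

/-! ### The Wilson integral over the line -/

/-- The product `Γ(a + z) Γ(a - z)`. -/
noncomputable def gammaPair (a z : ℂ) : ℂ := Complex.Gamma (a + z) * Complex.Gamma (a - z)

lemma differentiableAt_gammaPair {a z : ℂ} (h : |z.re| < a.re) :
    DifferentiableAt ℂ (gammaPair a) z := by
  rw [abs_lt] at h
  have hG : ∀ w : ℂ, 0 < w.re → DifferentiableAt ℂ Complex.Gamma w := by
    refine fun w hw => Complex.differentiableAt_Gamma w fun m hm => ?_
    have h1 := congrArg Complex.re hm
    have h2 : (0 : ℝ) ≤ m := Nat.cast_nonneg m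
    simp at h1
    linarith
  unfold gammaPair
  refine DifferentiableAt.mul ?_ ?_
  · exact (hG (a + z) (by rw [Complex.add_re]; linarith)).comp z (by fun_prop)
  · exact (hG (a - z) (by rw [Complex.sub_re]; linarith)).comp z (by fun_prop)

lemma continuous_gammaPair {a : ℂ} (ha : 0 < a.re) :
    Continuous fun s : ℝ => gammaPair a (Complex.I * s) := by
  refine continuous_iff_continuousAt.2 fun s => ?_
  exact ContinuousAt.comp (g := gammaPair a) (differentiableAt_gammaPair (by simpa)).continuousAt
    (by fun_prop)

/-- Any exponent below `π` would do; `3` suffices to beat `sinh (2πs)` with three factors. -/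
lemma exists_norm_gammaPair_le {a : ℂ} {r : ℝ} (h : r < a.re) : ∃ C : ℝ, 0 ≤ C ∧
    ∀ z : ℂ, |z.re| ≤ r → ‖gammaPair a z‖ ≤ C * Real.exp (-3 * |z.im|) := by
  obtain ⟨C, hC, hb⟩ := exists_norm_Gamma_strip_le (sub_pos.2 h) (a.re + r)
    (show (3 / 2 : ℝ) < Real.pi / 2 by linarith [Real.pi_gt_three])
  refine ⟨C * C, by positivity, fun z hz => ?_⟩
  rw [abs_le] at hz
  have h1 := hb (a + z) (by rw [Complex.add_re]; linarith) (by rw [Complex.add_re]; linarith)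
  have h2 := hb (a - z) (by rw [Complex.sub_re]; linarith) (by rw [Complex.sub_re]; linarith)
  rw [gammaPair, norm_mul]
  calc _ ≤ (C * Real.exp (-(3 / 2) * |(a + z).im|)) * (C * Real.exp (-(3 / 2) * |(a - z).im|)) := by
        gcongr
    _ = C * C * Real.exp (-(3 / 2) * (|(a + z).im| + |(a - z).im|)) := by
        rw [mul_add, Real.exp_add]; ring
    _ ≤ _ := by
        refine mul_le_mul_of_nonneg_left (Real.exp_le_exp.2 ?_) (by positivity)
        have := abs_sub (a + z).im (a - z).im
        rw [Complex.add_im, Complex.sub_im, show a.im + z.im - (a.im - z.im) = 2 * z.im by ring,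
          abs_mul, abs_two] at this
        rw [Complex.add_im, Complex.sub_im]
        linarith

lemma gammaPair_add_one {a : ℂ} (ha : 0 < a.re) (s : ℝ) :
    gammaPair (a + 1) (Complex.I * s) = (a ^ 2 + s ^ 2) * gammaPair a (Complex.I * s) := by
  have h1 : a + Complex.I * s ≠ 0 := fun h => by
    have := congrArg Complex.re h
    simp at this; linarith
  have h2 : a - Complex.I * s ≠ 0 := fun h => by
    have := congrArg Complex.re h
    simp at this; linarith
  rw [gammaPair, gammaPair, show a + 1 + Complex.I * s = a + Complex.I * s + 1 by ring,
    show a + 1 - Complex.I * s = a - Complex.I * s + 1 by ring, Complex.Gamma_add_one _ h1,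
    Complex.Gamma_add_one _ h2]
  linear_combination (-(s : ℂ) ^ 2 * Complex.Gamma (a + Complex.I * s) *
    Complex.Gamma (a - Complex.I * s)) * Complex.I_sq

lemma norm_ofReal_mul_sinh_le (s : ℝ) :
    ‖((s * Real.sinh (2 * Real.pi * s) : ℝ) : ℂ)‖ ≤ Real.exp (8 * |s|) := by
  have h1 : |Real.sinh (2 * Real.pi * s)| ≤ Real.exp (7 * |s|) := by
    rw [Real.abs_sinh, abs_mul, abs_of_pos (by positivity : 0 < 2 * Real.pi), Real.sinh_eq]
    have h2 : Real.exp (2 * Real.pi * |s|) ≤ Real.exp (7 * |s|) := by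
      have := Real.pi_lt_d2
      gcongr
      linarith
    have := Real.exp_pos (-(2 * Real.pi * |s|))
    have := Real.exp_pos (7 * |s|)
    linarith
  have h3 : |s| ≤ Real.exp |s| := by linarith [Real.add_one_le_exp |s|]
  rw [Complex.norm_real, Real.norm_eq_abs, abs_mul]
  calc _ ≤ Real.exp |s| * Real.exp (7 * |s|) := by gcongr
    _ = _ := by rw [← Real.exp_add]; ring_nf

/-- The integrand of Wilson's integral over the whole line, up to a constant factor:
`1 / |Γ(2is)|²`
equals `2 s sinh (2πs) / π`. -/
noncomputable def wilsonWeight (a b c d : ℂ) (s : ℝ) : ℂ :=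
  gammaPair a (Complex.I * s) * gammaPair b (Complex.I * s) * gammaPair c (Complex.I * s) *
    gammaPair d (Complex.I * s) * ((s * Real.sinh (2 * Real.pi * s) : ℝ) : ℂ)

/-- The integrand obtained from `wilsonWeight` by letting one parameter tend to infinity. -/
noncomputable def dualHahnWeight (b c d : ℂ) (s : ℝ) : ℂ :=
  gammaPair b (Complex.I * s) * gammaPair c (Complex.I * s) *
    gammaPair d (Complex.I * s) * ((s * Real.sinh (2 * Real.pi * s) : ℝ) : ℂ)

lemma wilsonWeight_eq (a b c d : ℂ) (s : ℝ) :
    wilsonWeight a b c d s = gammaPair a (Complex.I * s) * dualHahnWeight b c d s := by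
  rw [wilsonWeight, dualHahnWeight]; ring

section

variable {a b c d : ℂ}

lemma continuous_dualHahnWeight (hb : 0 < b.re) (hc : 0 < c.re) (hd : 0 < d.re) :
    Continuous (dualHahnWeight b c d) := by
  have := continuous_gammaPair hb
  have := continuous_gammaPair hc
  have := continuous_gammaPair hd
  have : Continuous fun s : ℝ => ((s * Real.sinh (2 * Real.pi * s) : ℝ) : ℂ) :=
    Complex.continuous_ofReal.comp
      (continuous_id.mul (Real.continuous_sinh.comp (continuous_const.mul continuous_id)))
  unfold dualHahnWeight
  fun_prop

lemma exists_norm_dualHahnWeight_le (hb : 0 < b.re) (hc : 0 < c.re) (hd : 0 < d.re) :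
    ∃ C : ℝ, 0 ≤ C ∧ ∀ s : ℝ, ‖dualHahnWeight b c d s‖ ≤ C * Real.exp (-|s|) := by
  obtain ⟨B, hB, hB'⟩ := exists_norm_gammaPair_le hb
  obtain ⟨C, hC, hC'⟩ := exists_norm_gammaPair_le hc
  obtain ⟨D, hD, hD'⟩ := exists_norm_gammaPair_le hd
  refine ⟨B * C * D, by positivity, fun s => ?_⟩
  have h1 := hB' (Complex.I * s) (by simp)
  have h2 := hC' (Complex.I * s) (by simp)
  have h3 := hD' (Complex.I * s) (by simp)
  simp only [Complex.mul_im, Complex.I_re, Complex.I_im, Complex.ofReal_re, Complex.ofReal_im,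
    one_mul, zero_add, mul_zero] at h1 h2 h3
  rw [dualHahnWeight, norm_mul, norm_mul, norm_mul]
  calc _ ≤ (B * Real.exp (-3 * |s|)) * (C * Real.exp (-3 * |s|)) * (D * Real.exp (-3 * |s|)) *
        Real.exp (8 * |s|) := by
        gcongr
        exact norm_ofReal_mul_sinh_le s
    _ = B * C * D * (Real.exp (-3 * |s|) * Real.exp (-3 * |s|) * Real.exp (-3 * |s|) *
        Real.exp (8 * |s|)) := by ring
    _ = _ := by
        rw [← Real.exp_add, ← Real.exp_add, ← Real.exp_add]
        ring_nf

lemma integrable_dualHahnWeight (hb : 0 < b.re) (hc : 0 < c.re) (hd : 0 < d.re) :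
    Integrable (dualHahnWeight b c d) := by
  obtain ⟨C, -, h⟩ := exists_norm_dualHahnWeight_le hb hc hd
  exact integrable_of_norm_le_exp_neg_abs (continuous_dualHahnWeight hb hc hd) h

lemma integrable_wilsonWeight (ha : 0 < a.re) (hb : 0 < b.re) (hc : 0 < c.re) (hd : 0 < d.re) :
    Integrable (wilsonWeight a b c d) := by
  obtain ⟨C, hC, h⟩ := exists_norm_dualHahnWeight_le hb hc hd
  obtain ⟨A, hA, h'⟩ := exists_norm_gammaPair_le ha
  have e : wilsonWeight a b c d =
      fun s : ℝ => gammaPair a (Complex.I * s) * dualHahnWeight b c d s :=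
    funext fun s => wilsonWeight_eq a b c d s
  rw [e]
  refine integrable_of_norm_le_exp_neg_abs (C := A * C)
    ((continuous_gammaPair ha).mul (continuous_dualHahnWeight hb hc hd)) fun s => ?_
  rw [norm_mul, mul_assoc]
  have h1 := h' (Complex.I * s) (by simp)
  have h2 : A * Real.exp (-3 * |(Complex.I * s).im|) ≤ A * 1 := by
    gcongr
    rw [Real.exp_le_one_iff]
    have := abs_nonneg (Complex.I * s).im
    linarith
  have h3 := h1.trans h2
  rw [mul_one] at h3
  gcongr
  exact h s

lemma norm_sin_two_pi_mul_le (z : ℂ) :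
    ‖Complex.sin (2 * Real.pi * z)‖ ≤ Real.exp (7 * |z.im|) := by
  have hπ := Real.pi_lt_d2
  have hi := abs_nonneg z.im
  have key : ∀ w : ℂ, |w.re| ≤ 7 * |z.im| → ‖Complex.exp w‖ ≤ Real.exp (7 * |z.im|) := by
    intro w hw
    rw [Complex.norm_exp]
    exact Real.exp_le_exp.2 ((le_abs_self _).trans hw)
  have hre : |2 * Real.pi * z.im| ≤ 7 * |z.im| := by
    rw [abs_mul, abs_of_pos (by positivity)]
    gcongr
    linarith
  have e : ((2 : ℂ) * Real.pi * z * Complex.I).re = -(2 * Real.pi * z.im) := by simp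
  have e' : (-((2 : ℂ) * Real.pi * z) * Complex.I).re = 2 * Real.pi * z.im := by simp
  rw [Complex.sin, norm_div, norm_mul, Complex.norm_I, mul_one, Complex.norm_two,
    div_le_iff₀ two_pos]
  refine (norm_sub_le _ _).trans ?_
  have h1 := key _ (by rw [e]; rw [abs_neg]; exact hre)
  have h2 := key _ (by rw [e']; exact hre)
  linarith

/-- As `sin (2πz)` is antiperiodic with antiperiod `1/2`, on the lines `re z = ±1/2` the function
`∏ Γ(aⱼ + 1/2 + z) Γ(aⱼ + 1/2 - z) sin (2πz)` is a common factor times `∏ (aⱼ ± is)`. Its integrals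
over the two lines agree, and the difference of the two products is `2is (e₃ - e₁ s²)`, with `eₖ` the
elementary symmetric functions of the parameters; so `e₁ s²` and `e₃` have the same integral
against the weight. -/
lemma add_mul_integral_wilsonWeight_add_one (ha : 0 < a.re) (hb : 0 < b.re) (hc : 0 < c.re)
    (hd : 0 < d.re) :
    (a + b + c + d) * ∫ s : ℝ, wilsonWeight (a + 1) b c d s =
      (a + b) * (a + c) * (a + d) * ∫ s : ℝ, wilsonWeight a b c d s := by
  have half : ∀ {w : ℂ}, 0 < w.re → 1 / 2 < (w + 1 / 2).re := fun {w} hw => by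
    norm_num; linarith
  let f : ℂ → ℂ := fun z => gammaPair (a + 1 / 2) z * gammaPair (b + 1 / 2) z *
    gammaPair (c + 1 / 2) z * gammaPair (d + 1 / 2) z * Complex.sin (2 * Real.pi * z)
  have hdiff : DifferentiableOn ℂ f {z | (-(1 / 2) : ℝ) ≤ z.re ∧ z.re ≤ (1 / 2 : ℝ)} := by
    intro z hz
    have hz' : |z.re| ≤ 1 / 2 := abs_le.2 hz
    have h1 := differentiableAt_gammaPair (hz'.trans_lt (half ha))
    have h2 := differentiableAt_gammaPair (hz'.trans_lt (half hb))
    have h3 := differentiableAt_gammaPair (hz'.trans_lt (half hc))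
    have h4 := differentiableAt_gammaPair (hz'.trans_lt (half hd))
    exact ((((h1.mul h2).mul h3).mul h4).mul (by fun_prop)).differentiableWithinAt
  obtain ⟨A, hA, hA'⟩ := exists_norm_gammaPair_le (half ha)
  obtain ⟨B, hB, hB'⟩ := exists_norm_gammaPair_le (half hb)
  obtain ⟨C, hC, hC'⟩ := exists_norm_gammaPair_le (half hc)
  obtain ⟨D, hD, hD'⟩ := exists_norm_gammaPair_le (half hd)
  have hbound : ∀ z : ℂ, (-(1 / 2) : ℝ) ≤ z.re → z.re ≤ (1 / 2 : ℝ) →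
      ‖f z‖ ≤ A * B * C * D * Real.exp (-|z.im|) := by
    intro z h1 h2
    have hz : |z.re| ≤ 1 / 2 := abs_le.2 ⟨h1, h2⟩
    have hA'' := hA' z hz
    have hB'' := hB' z hz
    have hC'' := hC' z hz
    have hD'' := hD' z hz
    simp only [f, norm_mul]
    calc _ ≤ (A * Real.exp (-3 * |z.im|)) * (B * Real.exp (-3 * |z.im|)) *
          (C * Real.exp (-3 * |z.im|)) * (D * Real.exp (-3 * |z.im|)) * Real.exp (7 * |z.im|) := by
          gcongr
          exact norm_sin_two_pi_mul_le z
      _ = A * B * C * D * (Real.exp (-3 * |z.im|) * Real.exp (-3 * |z.im|) *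
          Real.exp (-3 * |z.im|) * Real.exp (-3 * |z.im|) * Real.exp (7 * |z.im|)) := by ring
      _ ≤ _ := by
          rw [← Real.exp_add, ← Real.exp_add, ← Real.exp_add, ← Real.exp_add]
          gcongr
          linarith [abs_nonneg z.im]
  have hshift := integral_vertical_eq_integral_vertical (by norm_num) hdiff hbound
  have hsin : ∀ s : ℝ, Complex.sin (2 * Real.pi * (Complex.I * s)) =
      Complex.I * (Real.sinh (2 * Real.pi * s) : ℝ) := fun s => by
    rw [show (2 * Real.pi * (Complex.I * s) : ℂ) = (2 * Real.pi * s : ℂ) * Complex.I by ring,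
      Complex.sin_mul_I, mul_comm]
    push_cast; rfl
  have hne : ∀ {w : ℂ}, 0 < w.re → ∀ s : ℝ, w + Complex.I * s ≠ 0 ∧ w - Complex.I * s ≠ 0 := by
    intro w hw s
    constructor <;> intro h <;> have := congrArg Complex.re h <;> simp at this <;> linarith
  have hpair1 : ∀ {w : ℂ}, 0 < w.re → ∀ s : ℝ, gammaPair (w + 1 / 2) (1 / 2 + Complex.I * s) =
      (w + Complex.I * s) * gammaPair w (Complex.I * s) := fun {w} hw s => by
    rw [gammaPair, gammaPair,
      show w + 1 / 2 + (1 / 2 + Complex.I * s) = w + Complex.I * s + 1 by ring,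
      show w + 1 / 2 - (1 / 2 + Complex.I * s) = w - Complex.I * s by ring,
      Complex.Gamma_add_one _ (hne hw s).1]
    ring
  have hpair2 : ∀ {w : ℂ}, 0 < w.re → ∀ s : ℝ, gammaPair (w + 1 / 2) (-(1 / 2) + Complex.I * s) =
      (w - Complex.I * s) * gammaPair w (Complex.I * s) := fun {w} hw s => by
    rw [gammaPair, gammaPair,
      show w + 1 / 2 + (-(1 / 2) + Complex.I * s) = w + Complex.I * s by ring,
      show w + 1 / 2 - (-(1 / 2) + Complex.I * s) = w - Complex.I * s + 1 by ring,
      Complex.Gamma_add_one _ (hne hw s).2]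
    ring
  have hright : ∀ s : ℝ, f (((1 / 2 : ℝ) : ℂ) + s * Complex.I) =
      -Complex.I * ((a + Complex.I * s) * (b + Complex.I * s) * (c + Complex.I * s) *
        (d + Complex.I * s)) * (gammaPair a (Complex.I * s) * gammaPair b (Complex.I * s) *
        gammaPair c (Complex.I * s) * gammaPair d (Complex.I * s) *
        (Real.sinh (2 * Real.pi * s) : ℝ)) := fun s => by
    rw [show ((1 / 2 : ℝ) : ℂ) + s * Complex.I = 1 / 2 + Complex.I * s by push_cast; ring]
    simp only [f]
    rw [hpair1 ha, hpair1 hb, hpair1 hc, hpair1 hd,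
      show (2 * Real.pi * (1 / 2 + Complex.I * s) : ℂ) = 2 * Real.pi * (Complex.I * s) + Real.pi by
        ring, Complex.sin_add_pi, hsin]
    ring
  have hleft : ∀ s : ℝ, f (((-(1 / 2) : ℝ) : ℂ) + s * Complex.I) =
      -Complex.I * ((a - Complex.I * s) * (b - Complex.I * s) * (c - Complex.I * s) *
        (d - Complex.I * s)) * (gammaPair a (Complex.I * s) * gammaPair b (Complex.I * s) *
        gammaPair c (Complex.I * s) * gammaPair d (Complex.I * s) *
        (Real.sinh (2 * Real.pi * s) : ℝ)) := fun s => by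
    rw [show ((-(1 / 2) : ℝ) : ℂ) + s * Complex.I = -(1 / 2) + Complex.I * s by push_cast; ring]
    simp only [f]
    rw [hpair2 ha, hpair2 hb, hpair2 hc, hpair2 hd,
      show (2 * Real.pi * (-(1 / 2) + Complex.I * s) : ℂ) =
        2 * Real.pi * (Complex.I * s) - Real.pi by ring, Complex.sin_sub_pi, hsin]
    ring
  have hint : ∀ x : ℝ, -(1 / 2) ≤ x → x ≤ 1 / 2 →
      Integrable fun s : ℝ => f (x + s * Complex.I) := by
    intro x h1 h2
    refine integrable_of_norm_le_exp_neg_abs (C := A * B * C * D) ?_ fun s => ?_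
    · rw [← continuousOn_univ]
      refine hdiff.continuousOn.comp (by fun_prop) fun s _ => ?_
      simp only [Set.mem_ofPred_eq, Complex.add_re, Complex.ofReal_re, Complex.re_ofReal_mul,
        Complex.I_re, mul_zero, add_zero]
      exact ⟨h1, h2⟩
    · simpa using hbound (x + s * Complex.I) (by simpa using h1) (by simpa using h2)
  have hzero : ∫ s : ℝ, ((a + b + c + d) * wilsonWeight (a + 1) b c d s -
      (a + b) * (a + c) * (a + d) * wilsonWeight a b c d s) = 0 := by
    have h2 : ∀ s : ℝ, (a + b + c + d) * wilsonWeight (a + 1) b c d s -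
        (a + b) * (a + c) * (a + d) * wilsonWeight a b c d s =
        (1 / 2) * (f (((-(1 / 2) : ℝ) : ℂ) + s * Complex.I) -
          f (((1 / 2 : ℝ) : ℂ) + s * Complex.I)) := fun s => by
      rw [hleft, hright, wilsonWeight, wilsonWeight, gammaPair_add_one ha]
      push_cast
      have hI := Complex.I_sq
      linear_combination (-(s * (a * b * c + a * b * d + a * c * d + b * c * d) +
        s ^ 3 * (a + b + c + d) * (Complex.I ^ 2 - 1)) * (gammaPair a (Complex.I * s) *
        gammaPair b (Complex.I * s) * gammaPair c (Complex.I * s) * gammaPair d (Complex.I * s)) *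
        Complex.sinh (2 * Real.pi * s)) * hI
    simp_rw [h2]
    rw [integral_const_mul, integral_sub (hint _ le_rfl (by norm_num))
      (hint _ (by norm_num) le_rfl), hshift]
    ring
  have ha1 : 0 < (a + 1).re := by simp; linarith
  rw [integral_sub ((integrable_wilsonWeight ha1 hb hc hd).const_mul _)
    ((integrable_wilsonWeight ha hb hc hd).const_mul _), integral_const_mul,
    integral_const_mul] at hzero
  exact sub_eq_zero.1 hzero

end

/-! ### Independence of the parameters -/

/-- Wilson's integral divided by `∏ Γ(aᵢ + aⱼ) / Γ(a + b + c + d)`. -/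
noncomputable def wilsonRatio (a b c d : ℂ) : ℂ :=
  (∫ s : ℝ, wilsonWeight a b c d s) * Complex.Gamma (a + b + c + d) /
    (Complex.Gamma (a + b) * Complex.Gamma (a + c) * Complex.Gamma (a + d) *
      (Complex.Gamma (b + c) * Complex.Gamma (b + d) * Complex.Gamma (c + d)))

lemma wilsonRatio_add_one {a b c d : ℂ} (ha : 0 < a.re) (hb : 0 < b.re) (hc : 0 < c.re)
    (hd : 0 < d.re) : wilsonRatio (a + 1) b c d = wilsonRatio a b c d := by
  have h := add_mul_integral_wilsonWeight_add_one ha hb hc hd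
  have nab : a + b ≠ 0 := Complex.ne_zero_of_re_pos (by simp; linarith)
  have nac : a + c ≠ 0 := Complex.ne_zero_of_re_pos (by simp; linarith)
  have nad : a + d ≠ 0 := Complex.ne_zero_of_re_pos (by simp; linarith)
  have ns : a + b + c + d ≠ 0 := Complex.ne_zero_of_re_pos (by simp; linarith)
  rw [wilsonRatio, wilsonRatio, show a + 1 + b + c + d = a + b + c + d + 1 by ring,
    show a + 1 + b = a + b + 1 by ring, show a + 1 + c = a + c + 1 by ring,
    show a + 1 + d = a + d + 1 by ring, Complex.Gamma_add_one _ nab, Complex.Gamma_add_one _ nac,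
    Complex.Gamma_add_one _ nad, Complex.Gamma_add_one _ ns,
    show ((a + b) * Complex.Gamma (a + b) * ((a + c) * Complex.Gamma (a + c)) *
      ((a + d) * Complex.Gamma (a + d)) *
      (Complex.Gamma (b + c) * Complex.Gamma (b + d) * Complex.Gamma (c + d))) =
      ((a + b) * (a + c) * (a + d)) * (Complex.Gamma (a + b) * Complex.Gamma (a + c) *
      Complex.Gamma (a + d) *
      (Complex.Gamma (b + c) * Complex.Gamma (b + d) * Complex.Gamma (c + d))) by ring]
  refine Eq.trans ?_ (mul_div_mul_left _ _ (mul_ne_zero (mul_ne_zero nab nac) nad))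
  congr 1
  linear_combination Complex.Gamma (a + b + c + d) * h

lemma wilsonRatio_add_natCast {a b c d : ℂ} (ha : 0 < a.re) (hb : 0 < b.re) (hc : 0 < c.re)
    (hd : 0 < d.re) (n : ℕ) : wilsonRatio (a + n) b c d = wilsonRatio a b c d := by
  induction n with
  | zero => simp
  | succ n ih =>
    have hn : 0 < (a + n).re := by
      have : (0 : ℝ) ≤ n := Nat.cast_nonneg n
      simp; linarith
    rw [← ih, ← wilsonRatio_add_one hn hb hc hd]
    push_cast
    rw [add_assoc]

/-- The quotient `Γ(z + n + 1) / (n! n ^ z)`, which tends to `1`. -/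
noncomputable def gammaQuotient (n : ℕ) (z : ℂ) : ℂ :=
  Complex.Gamma (z + (n + 1)) / (n.factorial * (n : ℂ) ^ z)

lemma Complex.Gamma_add_natCast {z : ℂ} (hz : 0 < z.re) (n : ℕ) :
    Complex.Gamma (z + n) = (∏ j ∈ Finset.range n, (z + j)) * Complex.Gamma z := by
  induction n with
  | zero => simp
  | succ n ih =>
    have hn : z + n ≠ 0 := Complex.ne_zero_of_re_pos (by
      have : (0 : ℝ) ≤ n := Nat.cast_nonneg n
      simp; linarith)
    rw [Finset.prod_range_succ, Nat.cast_succ, ← add_assoc, Complex.Gamma_add_one _ hn, ih]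
    ring

lemma tendsto_gammaQuotient {z : ℂ} (hz : 0 < z.re) :
    Tendsto (fun n => gammaQuotient n z) atTop (𝓝 1) := by
  have hG := Complex.Gamma_ne_zero_of_re_pos hz
  have h := (tendsto_const_nhds (x := Complex.Gamma z)).div (Complex.GammaSeq_tendsto_Gamma z) hG
  rw [div_self hG] at h
  refine h.congr fun n => ?_
  have e := Complex.Gamma_add_natCast hz (n + 1)
  push_cast at e
  rw [Pi.div_apply, gammaQuotient, e, Complex.GammaSeq, div_div_eq_mul_div]
  ring

lemma Complex.Gamma_add_eq_gammaQuotient (z : ℂ) {n : ℕ} (hn : 0 < n) :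
    Complex.Gamma (z + (n + 1)) = gammaQuotient n z * (n.factorial * (n : ℂ) ^ z) := by
  have h1 : (n.factorial : ℂ) ≠ 0 := Nat.cast_ne_zero.2 n.factorial_ne_zero
  have h2 : (n : ℂ) ^ z ≠ 0 := by simp [Complex.cpow_eq_zero_iff, hn.ne']
  rw [gammaQuotient, div_mul_cancel₀ _ (mul_ne_zero h1 h2)]

lemma exists_norm_gammaQuotient_le {x : ℝ} (hx : 0 < x) :
    ∃ C : ℝ, 0 ≤ C ∧ ∀ n : ℕ, 0 < n → ∀ z : ℂ, z.re = x → ‖gammaQuotient n z‖ ≤ C := by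
  obtain ⟨C, hC⟩ := (tendsto_gammaQuotient (z := (x : ℂ)) (by simpa)).norm.bddAbove_range
  refine ⟨C, (norm_nonneg _).trans (hC ⟨0, rfl⟩), fun n hn z hz => le_trans ?_ (hC ⟨n, rfl⟩)⟩
  have hn' : (0 : ℝ) ≤ n := Nat.cast_nonneg n
  have h1 : 0 < (z + (n + 1)).re := by simp; linarith
  have e : ((x : ℂ) + (n + 1)) = ((x + (n + 1) : ℝ) : ℂ) := by push_cast; ring
  simp only [gammaQuotient, norm_div, norm_mul, Complex.norm_natCast_cpow_of_pos hn]
  rw [hz, Complex.ofReal_re, e, Complex.Gamma_ofReal, Complex.norm_real, Real.norm_eq_abs,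
    abs_of_pos (Real.Gamma_pos_of_pos (by linarith))]
  gcongr
  have := Complex.norm_Gamma_le_Gamma_re h1
  simpa [hz] using this

lemma tendsto_integral_gammaQuotient_mul {a b c d : ℂ} (ha : 0 < a.re) (hb : 0 < b.re)
    (hc : 0 < c.re) (hd : 0 < d.re) :
    Tendsto (fun n : ℕ => ∫ s : ℝ, gammaQuotient n (a + Complex.I * s) *
      gammaQuotient n (a - Complex.I * s) * dualHahnWeight b c d s) atTop
      (𝓝 (∫ s : ℝ, dualHahnWeight b c d s)) := by
  obtain ⟨C, hC, hb'⟩ := exists_norm_gammaQuotient_le ha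
  have hre1 : ∀ s : ℝ, (a + Complex.I * s).re = a.re := fun s => by simp
  have hre2 : ∀ s : ℝ, (a - Complex.I * s).re = a.re := fun s => by simp
  refine tendsto_integral_filter_of_dominated_convergence
    (fun s => C * C * ‖dualHahnWeight b c d s‖) ?_ ?_ ?_ ?_
  · filter_upwards [eventually_gt_atTop 0] with n hn
    refine Continuous.aestronglyMeasurable (Continuous.mul ?_ (continuous_dualHahnWeight hb hc hd))
    have hn1 : 0 < (a + (n + 1)).re := by
      have : (0 : ℝ) ≤ n := Nat.cast_nonneg n
      simp; linarith
    have hne : (n : ℂ) ≠ 0 := Nat.cast_ne_zero.2 hn.ne'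
    have e : (fun s : ℝ => gammaQuotient n (a + Complex.I * s) *
        gammaQuotient n (a - Complex.I * s)) =
        fun s : ℝ => gammaPair (a + (n + 1)) (Complex.I * s) /
          ((n.factorial * (n : ℂ) ^ a) * (n.factorial * (n : ℂ) ^ a)) := by
      funext s
      have h2 : (n : ℂ) ^ (Complex.I * s) ≠ 0 := by simp [Complex.cpow_eq_zero_iff, hne]
      rw [gammaPair, gammaQuotient, gammaQuotient, Complex.cpow_add _ _ hne,
        Complex.cpow_sub _ _ hne, show a + Complex.I * s + (n + 1) = a + (n + 1) + Complex.I * s by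
          ring, show a - Complex.I * s + (n + 1) = a + (n + 1) - Complex.I * s by ring]
      field_simp
    rw [e]
    exact (continuous_gammaPair hn1).div_const _
  · filter_upwards [eventually_gt_atTop 0] with n hn
    refine ae_of_all _ fun s => ?_
    rw [norm_mul, norm_mul]
    gcongr
    exacts [hb' n hn _ (hre1 s), hb' n hn _ (hre2 s)]
  · exact (integrable_dualHahnWeight hb hc hd).norm.const_mul _
  · refine ae_of_all _ fun s => ?_
    have h1 := tendsto_gammaQuotient (z := a + Complex.I * s) (by rwa [hre1])
    have h2 := tendsto_gammaQuotient (z := a - Complex.I * s) (by rwa [hre2])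
    simpa using (h1.mul h2).mul_const (dualHahnWeight b c d s)

/-- The ratio is invariant under `a ↦ a + 1` and has a limit as `a` tends to infinity along these
shifts, which does not involve `a`. -/
lemma wilsonRatio_eq_dualHahn {a b c d : ℂ} (ha : 0 < a.re) (hb : 0 < b.re) (hc : 0 < c.re)
    (hd : 0 < d.re) : wilsonRatio a b c d = (∫ s : ℝ, dualHahnWeight b c d s) /
      (Complex.Gamma (b + c) * Complex.Gamma (b + d) * Complex.Gamma (c + d)) := by
  have pos : ∀ {z w : ℂ}, 0 < z.re → 0 < w.re → 0 < (z + w).re := fun {z w} hz hw => by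
    rw [Complex.add_re]; exact add_pos hz hw
  have hlim := (((tendsto_integral_gammaQuotient_mul ha hb hc hd).mul
    (tendsto_gammaQuotient (pos (pos (pos ha hb) hc) hd))).div
    (((tendsto_gammaQuotient (pos ha hb)).mul (tendsto_gammaQuotient (pos ha hc))).mul
      (tendsto_gammaQuotient (pos ha hd))) (by norm_num)).div_const
    (Complex.Gamma (b + c) * Complex.Gamma (b + d) * Complex.Gamma (c + d))
  simp only [mul_one, div_one] at hlim
  refine tendsto_nhds_unique (tendsto_const_nhds.congr' ?_) hlim
  filter_upwards [eventually_gt_atTop 0] with n hn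
  have hne : (n : ℂ) ≠ 0 := Nat.cast_ne_zero.2 hn.ne'
  have h1 : (n.factorial : ℂ) ≠ 0 := Nat.cast_ne_zero.2 n.factorial_ne_zero
  have hcp : ∀ z : ℂ, (n : ℂ) ^ z ≠ 0 := fun z => by simp [Complex.cpow_eq_zero_iff, hne]
  have hint : ∫ s : ℝ, wilsonWeight (a + (n + 1)) b c d s =
      ((n.factorial * (n : ℂ) ^ a) * (n.factorial * (n : ℂ) ^ a)) *
      ∫ s : ℝ, gammaQuotient n (a + Complex.I * s) *
        gammaQuotient n (a - Complex.I * s) * dualHahnWeight b c d s := by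
    rw [← integral_const_mul]
    refine integral_congr_ae (ae_of_all _ fun s => ?_)
    simp only []
    have h2 := hcp (Complex.I * s)
    rw [wilsonWeight_eq, gammaPair,
      show a + (n + 1) + Complex.I * s = a + Complex.I * s + (n + 1) by ring,
      show a + (n + 1) - Complex.I * s = a - Complex.I * s + (n + 1) by ring,
      Complex.Gamma_add_eq_gammaQuotient _ hn, Complex.Gamma_add_eq_gammaQuotient _ hn,
      Complex.cpow_add _ _ hne, Complex.cpow_sub _ _ hne]
    field_simp
  have hshift := wilsonRatio_add_natCast ha hb hc hd (n + 1)
  push_cast at hshift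
  have hq : ∀ {z : ℂ}, 0 < z.re → gammaQuotient n z ≠ 0 := fun {z} hz => by
    refine div_ne_zero (Complex.Gamma_ne_zero_of_re_pos ?_) (mul_ne_zero h1 (hcp z))
    have : (0 : ℝ) ≤ n := Nat.cast_nonneg n
    simp; linarith
  have q1 := hq (pos ha hb)
  have q2 := hq (pos ha hc)
  have q3 := hq (pos ha hd)
  have g1 := Complex.Gamma_ne_zero_of_re_pos (pos hb hc)
  have g2 := Complex.Gamma_ne_zero_of_re_pos (pos hb hd)
  have g3 := Complex.Gamma_ne_zero_of_re_pos (pos hc hd)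
  have p1 := hcp a
  have p2 := hcp b
  have p3 := hcp c
  have p4 := hcp d
  rw [← hshift, wilsonRatio, hint,
    show a + (n + 1) + b + c + d = a + b + c + d + (n + 1) by ring,
    show a + (n + 1) + b = a + b + (n + 1) by ring, show a + (n + 1) + c = a + c + (n + 1) by ring,
    show a + (n + 1) + d = a + d + (n + 1) by ring,
    Complex.Gamma_add_eq_gammaQuotient _ hn, Complex.Gamma_add_eq_gammaQuotient _ hn,
    Complex.Gamma_add_eq_gammaQuotient _ hn, Complex.Gamma_add_eq_gammaQuotient _ hn]
  simp only [Pi.div_apply]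
  generalize (∫ s : ℝ, gammaQuotient n (a + Complex.I * s) *
        gammaQuotient n (a - Complex.I * s) * dualHahnWeight b c d s) = J
  have ecp : (n : ℂ) ^ (a + b + c + d) = (n : ℂ) ^ a * (n : ℂ) ^ b * (n : ℂ) ^ c * (n : ℂ) ^ d := by
    rw [Complex.cpow_add _ _ hne, Complex.cpow_add _ _ hne, Complex.cpow_add _ _ hne]
  rw [ecp, Complex.cpow_add a b hne, Complex.cpow_add a c hne, Complex.cpow_add a d hne]
  field_simp

lemma wilsonRatio_rotate (a b c d : ℂ) : wilsonRatio a b c d = wilsonRatio b c d a := by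
  have h : ∀ s, wilsonWeight a b c d s = wilsonWeight b c d a s := fun s => by
    simp only [wilsonWeight]; ring
  simp only [wilsonRatio, h, add_comm b a, add_comm c a, add_comm d a,
    show b + c + d + a = a + b + c + d by ring]
  ring

/-- Symmetry in the parameters turns independence of one parameter into independence of all. -/
lemma wilsonRatio_eq_wilsonRatio {a b c d a' b' c' d' : ℂ} (ha : 0 < a.re) (hb : 0 < b.re)
    (hc : 0 < c.re) (hd : 0 < d.re) (ha' : 0 < a'.re) (hb' : 0 < b'.re) (hc' : 0 < c'.re)
    (hd' : 0 < d'.re) : wilsonRatio a b c d = wilsonRatio a' b' c' d' := by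
  have key : ∀ {p q r s p' : ℂ}, 0 < p.re → 0 < q.re → 0 < r.re → 0 < s.re → 0 < p'.re →
      wilsonRatio p q r s = wilsonRatio q r s p' := fun {p q r s p'} hp hq hr hs hp' => by
    rw [wilsonRatio_eq_dualHahn hp hq hr hs, ← wilsonRatio_eq_dualHahn hp' hq hr hs,
      wilsonRatio_rotate]
  rw [key ha hb hc hd ha', key hb hc hd ha' hb', key hc hd ha' hb' hc', key hd ha' hb' hc' hd']

/-! ### Evaluation at one choice of parameters -/

lemma integral_eq_two_mul_integral_Ioi {f : ℝ → ℂ} (hf : Integrable f)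
    (he : ∀ s, f (-s) = f s) : ∫ s, f s = 2 * ∫ s in Set.Ioi (0 : ℝ), f s := by
  have h := integral_comp_neg_Iic (0 : ℝ) f
  simp only [he, neg_zero] at h
  rw [← intervalIntegral.integral_Iic_add_Ioi (b := 0) hf.integrableOn hf.integrableOn, h, two_mul]

lemma wilsonWeight_neg (a b c d : ℂ) (s : ℝ) :
    wilsonWeight a b c d (-s) = wilsonWeight a b c d s := by
  have h : ∀ p : ℂ, gammaPair p (Complex.I * ((-s : ℝ) : ℂ)) = gammaPair p (Complex.I * s) := by
    intro p
    rw [gammaPair, gammaPair, mul_comm]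
    push_cast
    congr 2 <;> ring
  simp only [wilsonWeight, h, mul_neg, Real.sinh_neg, neg_mul, neg_neg]

lemma Complex.sin_pi_mul_I_mul (s : ℝ) :
    Complex.sin (Real.pi * (Complex.I * s)) = Complex.I * (Real.sinh (Real.pi * s) : ℝ) := by
  rw [show (Real.pi * (Complex.I * s) : ℂ) = (Real.pi * s : ℂ) * Complex.I by ring,
    Complex.sin_mul_I, mul_comm]
  push_cast; rfl

lemma gammaPair_one_half (s : ℝ) :
    gammaPair (1 / 2) (Complex.I * s) = (Real.pi / Real.cosh (Real.pi * s) : ℝ) := by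
  have h := Complex.Gamma_mul_Gamma_one_sub (1 / 2 + Complex.I * s)
  rw [show (1 : ℂ) - (1 / 2 + Complex.I * s) = 1 / 2 - Complex.I * s by ring,
    show (Real.pi * (1 / 2 + Complex.I * s) : ℂ) = (Real.pi * s : ℂ) * Complex.I + Real.pi / 2 by
      ring, Complex.sin_add_pi_div_two, Complex.cos_mul_I] at h
  rw [gammaPair, h]
  push_cast; rfl

lemma gammaPair_one {s : ℝ} (hs : 0 < s) :
    gammaPair 1 (Complex.I * s) = (Real.pi * s / Real.sinh (Real.pi * s) : ℝ) := by
  have hI : Complex.I * s ≠ 0 := mul_ne_zero Complex.I_ne_zero (by exact_mod_cast hs.ne')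
  have h := Complex.Gamma_mul_Gamma_one_sub (Complex.I * s)
  have hsh : ((Real.sinh (Real.pi * s) : ℝ) : ℂ) ≠ 0 := by
    exact_mod_cast (Real.sinh_pos_iff.2 (mul_pos Real.pi_pos hs)).ne'
  rw [gammaPair, add_comm, Complex.Gamma_add_one _ hI, mul_assoc, h, Complex.sin_pi_mul_I_mul,
    Complex.ofReal_div, Complex.ofReal_mul]
  have := Complex.I_ne_zero
  field_simp

lemma hasSum_one_div_odd_pow_four :
    HasSum (fun k : ℕ => (1 : ℝ) / (2 * k + 1) ^ 4) (Real.pi ^ 4 / 96) := by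
  have hs : Summable fun k : ℕ => (1 : ℝ) / (2 * k + 1) ^ 4 := by
    have := hasSum_zeta_four.summable.comp_injective (i := fun k : ℕ => 2 * k + 1)
      (fun x y h => by simpa using h)
    refine this.congr fun k => ?_
    simp
  have he : HasSum (fun k : ℕ => (1 : ℝ) / ((2 * k : ℕ) : ℝ) ^ 4) (Real.pi ^ 4 / 90 / 16) := by
    refine (hasSum_zeta_four.div_const 16).congr_fun ?_
    intro k
    push_cast
    rw [mul_pow, div_div]
    norm_num [mul_comm]
  have ho : HasSum (fun k : ℕ => (1 : ℝ) / ((2 * k + 1 : ℕ) : ℝ) ^ 4)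
      (∑' k : ℕ, (1 : ℝ) / (2 * k + 1) ^ 4) := by
    simpa using hs.hasSum
  have h := (HasSum.even_add_odd (f := fun n : ℕ => (1 : ℝ) / (n : ℝ) ^ 4) he ho).unique
    hasSum_zeta_four
  have : (∑' k : ℕ, (1 : ℝ) / (2 * k + 1) ^ 4) = Real.pi ^ 4 / 96 := by linarith
  rw [← this]
  exact hs.hasSum

lemma hasSum_exp_odd_mul {x : ℝ} (hx : 0 < x) :
    HasSum (fun k : ℕ => 2 * Real.exp (-((2 * k + 1) * x))) (1 / Real.sinh x) := by
  have h1 : Real.exp (-(2 * x)) < 1 := by rw [Real.exp_lt_one_iff]; linarith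
  have h := (hasSum_geometric_of_lt_one (Real.exp_pos _).le h1).mul_left (2 * Real.exp (-x))
  have e : 2 * Real.exp (-x) * (1 - Real.exp (-(2 * x)))⁻¹ = 1 / Real.sinh x := by
    have h2 : 0 < 1 - Real.exp (-(2 * x)) := sub_pos.2 h1
    have h3 := Real.sinh_pos_iff.2 hx
    rw [← div_eq_mul_inv, div_eq_div_iff h2.ne' h3.ne', Real.sinh_eq]
    have h4 : Real.exp (-x) * Real.exp x = 1 := by rw [← Real.exp_add]; simp
    have h5 : Real.exp (-(2 * x)) = Real.exp (-x) * Real.exp (-x) := by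
      rw [← Real.exp_add]; ring_nf
    rw [h5]
    linear_combination h4
  rw [e] at h
  refine h.congr_fun fun k => ?_
  rw [← Real.exp_nat_mul, mul_assoc, ← Real.exp_add]
  ring_nf

lemma integral_cube_div_sinh :
    ∫ s in Set.Ioi (0 : ℝ), ((s ^ 3 / Real.sinh (2 * Real.pi * s) : ℝ) : ℂ) = 1 / 128 := by
  have hodd : HasSum (fun k : ℕ => (1 : ℂ) / (2 * k + 1) ^ 4) ((Real.pi : ℂ) ^ 4 / 96) := by
    have := Complex.hasSum_ofReal.2 hasSum_one_div_odd_pow_four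
    push_cast at this
    exact this
  -- Integrate the expansion `1 / sinh (2πs) = 2 ∑ exp (-2π (2k + 1) s)` term by term against `s³`.
  have hm := hasSum_mellin (a := fun _ : ℕ => (2 : ℂ)) (p := fun k : ℕ => 2 * Real.pi * (2 * k + 1))
    (F := fun t : ℝ => ((1 / Real.sinh (2 * Real.pi * t) : ℝ) : ℂ)) (s := 4)
    (fun k => Or.inr (by positivity)) (by norm_num) ?_ ?_
  · have h2 := (hodd.mul_left (12 / (2 * Real.pi : ℂ) ^ 4))
    have hG : Complex.Gamma 4 = 6 := by
      norm_num [Nat.factorial]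
    have hπ : (Real.pi : ℂ) ≠ 0 := by exact_mod_cast Real.pi_ne_zero
    have h3 := hm.unique (h2.congr_fun fun k => ?_)
    · have h4 : mellin (fun t : ℝ => ((1 / Real.sinh (2 * Real.pi * t) : ℝ) : ℂ)) 4 =
          ∫ s in Set.Ioi (0 : ℝ), ((s ^ 3 / Real.sinh (2 * Real.pi * s) : ℝ) : ℂ) := by
        rw [mellin]
        refine setIntegral_congr_fun measurableSet_Ioi fun s hs => ?_
        rw [show (4 : ℂ) - 1 = ((3 : ℕ) : ℂ) by norm_num, Complex.cpow_natCast, smul_eq_mul]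
        push_cast
        ring
      rw [← h4, h3]
      field_simp
      norm_num
    · have hk : (2 * k + 1 : ℂ) ≠ 0 := by exact_mod_cast Nat.succ_ne_zero (2 * k)
      rw [hG, show (4 : ℂ) = ((4 : ℕ) : ℂ) by norm_num, Complex.cpow_natCast]
      push_cast
      field_simp
      norm_num
  · intro t ht
    have hx : 0 < 2 * Real.pi * t := by
      have : 0 < t := ht
      positivity
    have := Complex.hasSum_ofReal.2 (hasSum_exp_odd_mul hx)
    refine this.congr_fun fun k => ?_
    push_cast
    ring_nf
  · have := (hasSum_one_div_odd_pow_four.summable.mul_left (2 / (2 * Real.pi) ^ 4))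
    refine this.congr fun k => ?_
    rw [show (4 : ℂ).re = ((4 : ℕ) : ℝ) by norm_num, Real.rpow_natCast, Complex.norm_two]
    field_simp

lemma integral_wilsonWeight_special :
    ∫ s : ℝ, wilsonWeight (1 / 2) 1 (1 / 2) 1 s = Real.pi ^ 4 / 16 := by
  have h2 : 0 < (1 / 2 : ℂ).re := by norm_num
  have h1 : 0 < (1 : ℂ).re := by norm_num
  rw [integral_eq_two_mul_integral_Ioi (integrable_wilsonWeight h2 h1 h2 h1)
    (wilsonWeight_neg _ _ _ _)]
  have e : ∫ s in Set.Ioi (0 : ℝ), wilsonWeight (1 / 2) 1 (1 / 2) 1 s =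
      ∫ s in Set.Ioi (0 : ℝ),
        (4 * Real.pi ^ 4 : ℂ) * ((s ^ 3 / Real.sinh (2 * Real.pi * s) : ℝ) : ℂ) := by
    refine setIntegral_congr_fun measurableSet_Ioi fun s hs => ?_
    have hs' : 0 < s := hs
    have hc := (Real.cosh_pos (Real.pi * s)).ne'
    have hsh := (Real.sinh_pos_iff.2 (mul_pos Real.pi_pos hs')).ne'
    simp only [wilsonWeight]
    rw [gammaPair_one_half, gammaPair_one hs', mul_assoc 2, Real.sinh_two_mul]
    norm_cast
    field_simp
    norm_num
  rw [e, integral_const_mul, integral_cube_div_sinh]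
  ring

lemma wilsonRatio_special : wilsonRatio (1 / 2) 1 (1 / 2) 1 = 2 * Real.pi ^ 2 := by
  have hG3 : Complex.Gamma (1 / 2 + 1 + 1 / 2 + 1) = 2 := by
    norm_num [Nat.factorial]
  have hG2 : Complex.Gamma (1 + 1) = 1 := by
    rw [Complex.Gamma_add_one _ one_ne_zero, Complex.Gamma_one, one_mul]
  have hG1 : Complex.Gamma (1 / 2 + 1 / 2) = 1 := by
    rw [add_halves, Complex.Gamma_one]
  have hh : Complex.Gamma (1 / 2 + 1) * Complex.Gamma (1 / 2 + 1) = Real.pi / 4 := by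
    have h := Complex.Gamma_one_half_eq
    have hsq : ((Real.pi : ℂ) ^ (1 / 2 : ℂ)) * ((Real.pi : ℂ) ^ (1 / 2 : ℂ)) = Real.pi := by
      rw [← Complex.cpow_add _ _ (by exact_mod_cast Real.pi_ne_zero)]
      norm_num
    rw [Complex.Gamma_add_one _ (by norm_num), h]
    linear_combination (1 / 4) * hsq
  rw [wilsonRatio, integral_wilsonWeight_special, hG3, hG2, hG1, add_comm (1 : ℂ) (1 / 2),
    show ∀ x : ℂ, x * 1 * x * (x * 1 * x) = (x * x) * (x * x) by intro x; ring, hh]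
  have hπ : (Real.pi : ℂ) ≠ 0 := by exact_mod_cast Real.pi_ne_zero
  field_simp
  norm_num

/-- The de Branges–Wilson beta integral, for complex parameters with positive real part. -/
theorem integral_Ioi_wilsonWeight {a b c d : ℂ} (ha : 0 < a.re) (hb : 0 < b.re) (hc : 0 < c.re)
    (hd : 0 < d.re) :
    wilsonK a b c d * ∫ s in Set.Ioi (0 : ℝ), wilsonWeight a b c d s = Real.pi / 4 := by
  have h2 : 0 < (1 / 2 : ℂ).re := by norm_num
  have h1 : 0 < (1 : ℂ).re := by norm_num
  have h := wilsonRatio_eq_wilsonRatio ha hb hc hd h2 h1 h2 h1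
  rw [wilsonRatio_special, wilsonRatio, integral_eq_two_mul_integral_Ioi
    (integrable_wilsonWeight ha hb hc hd) (wilsonWeight_neg _ _ _ _)] at h
  have hπ : (Real.pi : ℂ) ≠ 0 := by exact_mod_cast Real.pi_ne_zero
  calc _ = (2 * (∫ s in Set.Ioi (0 : ℝ), wilsonWeight a b c d s) * Complex.Gamma (a + b + c + d) /
      (Complex.Gamma (a + b) * Complex.Gamma (a + c) * Complex.Gamma (a + d) *
      (Complex.Gamma (b + c) * Complex.Gamma (b + d) * Complex.Gamma (c + d)))) /
      (8 * Real.pi) := by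
        rw [wilsonK, div_div, div_mul_eq_mul_div]
        have : ∀ x y z w : ℂ, x = 2 * z → y * 2 = w → z / y = x / w := by
          rintro x y z w rfl rfl
          rw [mul_comm y 2, mul_div_mul_left _ _ two_ne_zero]
        refine this _ _ _ _ (by ring) (by ring)
    _ = _ := by
        rw [h]
        field_simp
        norm_num

/-! ### Wilson's density -/

lemma IsAdmissiblePair.add_ofReal {p q : ℂ} (h : IsAdmissiblePair p q) {m : ℝ} (hm : 0 < m) :
    IsAdmissiblePair (p + m) (q + m) := by
  obtain ⟨h1, h2, h3⟩ := h
  refine ⟨by simp; linarith, by simp; linarith, ?_⟩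
  rcases h3 with h3 | h3
  · left; simpa using h3
  · right; simp [h3]

lemma isAdmissiblePair_add_sub {m : ℝ} (hm : 0 < m) (s : ℝ) :
    IsAdmissiblePair (m + Complex.I * s) (m - Complex.I * s) :=
  ⟨by simpa, by simpa, Or.inr (by simp [sub_eq_add_neg])⟩

lemma IsAdmissiblePair.norm_sq_Gamma_mul_Gamma {p q : ℂ} (h : IsAdmissiblePair p q) (s : ℝ) :
    ((‖Complex.Gamma (p + Complex.I * s) * Complex.Gamma (q + Complex.I * s)‖ ^ 2 : ℝ) : ℂ) =
      gammaPair p (Complex.I * s) * gammaPair q (Complex.I * s) := by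
  rw [← Complex.normSq_eq_norm_sq, ← Complex.mul_conj, map_mul, ← Complex.Gamma_conj,
    ← Complex.Gamma_conj, gammaPair, gammaPair]
  simp only [map_add, map_mul, Complex.conj_I, Complex.conj_ofReal, neg_mul, ← sub_eq_add_neg]
  rcases h.2.2 with ⟨hp, hq⟩ | rfl
  · rw [Complex.conj_eq_iff_im.2 hp, Complex.conj_eq_iff_im.2 hq]
    ring
  · rw [Complex.conj_conj]
    ring

lemma norm_sq_Gamma_two_mul_I {s : ℝ} (hs : 0 < s) :
    ‖Complex.Gamma (2 * Complex.I * s)‖ ^ 2 =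
      Real.pi / (2 * s * Real.sinh (2 * Real.pi * s)) := by
  have hr : 0 < 2 * s := by linarith
  have hne : (2 * s : ℂ) ≠ 0 := by exact_mod_cast hr.ne'
  have hI := Complex.I_ne_zero
  have hsh : ((Real.sinh (Real.pi * (2 * s)) : ℝ) : ℂ) ≠ 0 := by
    exact_mod_cast (Real.sinh_pos_iff.2 (mul_pos Real.pi_pos hr)).ne'
  have h := Complex.Gamma_mul_Gamma_one_sub (Complex.I * ((2 * s : ℝ) : ℂ))
  have hz : -(Complex.I * ((2 * s : ℝ) : ℂ)) ≠ 0 := by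
    push_cast
    exact neg_ne_zero.2 (mul_ne_zero hI hne)
  rw [Complex.sin_pi_mul_I_mul, sub_eq_neg_add, Complex.Gamma_add_one _ hz,
    eq_div_iff (mul_ne_zero hI hsh)] at h
  have e1 : (2 * Complex.I * s : ℂ) = Complex.I * ((2 * s : ℝ) : ℂ) := by push_cast; ring
  have e2 : -(Complex.I * ((2 * s : ℝ) : ℂ)) = (starRingEnd ℂ) (Complex.I * ((2 * s : ℝ) : ℂ)) := by
    rw [map_mul, Complex.conj_I, Complex.conj_ofReal, neg_mul]
  have h3 : (((‖Complex.Gamma (2 * Complex.I * s)‖ ^ 2 : ℝ) : ℂ)) =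
      ((Real.pi / (2 * s * Real.sinh (Real.pi * (2 * s))) : ℝ) : ℂ) := by
    rw [← Complex.normSq_eq_norm_sq, ← Complex.mul_conj, e1, ← Complex.Gamma_conj, ← e2]
    push_cast at h hsh ⊢
    rw [eq_div_iff (mul_ne_zero hne hsh)]
    linear_combination h + (2 * s) * Complex.sinh (Real.pi * (2 * s)) *
      Complex.Gamma (Complex.I * (2 * s)) * Complex.Gamma (-(Complex.I * (2 * s))) * Complex.I_sq
  rw [show 2 * Real.pi * s = Real.pi * (2 * s) by ring]
  exact_mod_cast h3

lemma wilsonDensity_eq {a b c d : ℂ} (hab : IsAdmissiblePair a b) (hcd : IsAdmissiblePair c d)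
    {x : ℝ} (hx : 0 < x) :
    wilsonDensity x a b c d = 2 / (Real.pi * √x) * (wilsonK a b c d * wilsonWeight a b c d (√x)) := by
  have hs : 0 < √x := Real.sqrt_pos.2 hx
  have hsc : ((√x : ℝ) : ℂ) ≠ 0 := by exact_mod_cast hs.ne'
  have hπ : (Real.pi : ℂ) ≠ 0 := by exact_mod_cast Real.pi_ne_zero
  rw [wilsonDensity, mul_assoc (Complex.Gamma (a + _) * _), norm_mul, mul_pow, Complex.ofReal_div,
    Complex.ofReal_mul, hab.norm_sq_Gamma_mul_Gamma, hcd.norm_sq_Gamma_mul_Gamma,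
    norm_sq_Gamma_two_mul_I hs, wilsonWeight]
  push_cast
  have hsh : Complex.sinh (2 * Real.pi * (√x : ℝ)) ≠ 0 := by
    exact_mod_cast (Real.sinh_pos_iff.2 (show 0 < 2 * Real.pi * √x by positivity)).ne'
  field_simp

/-- Wilson's density is a probability density: the substitution `x = s²` turns its integral into
the de Branges–Wilson integral. -/
lemma integrableOn_and_integral_wilsonDensity {a b c d : ℂ} (hab : IsAdmissiblePair a b)
    (hcd : IsAdmissiblePair c d) :
    IntegrableOn (fun x => wilsonDensity x a b c d) (Set.Ioi 0) ∧
      ∫ x in Set.Ioi (0 : ℝ), wilsonDensity x a b c d = 1 := by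
  have hsub : ∀ s ∈ Set.Ioi (0 : ℝ),
      (|(2 : ℝ)| * s ^ ((2 : ℝ) - 1)) • wilsonDensity (s ^ (2 : ℝ)) a b c d =
      4 / Real.pi * wilsonK a b c d * wilsonWeight a b c d s := by
    intro s hs
    have hs' : 0 < s := hs
    have hsc : (s : ℂ) ≠ 0 := by exact_mod_cast hs'.ne'
    have hπ : (Real.pi : ℂ) ≠ 0 := by exact_mod_cast Real.pi_ne_zero
    rw [wilsonDensity_eq hab hcd (by positivity), Real.rpow_two, Real.sqrt_sq hs'.le, abs_two,
      show (2 : ℝ) - 1 = 1 by norm_num, Real.rpow_one, Complex.real_smul]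
    push_cast
    field_simp
    ring
  have hint := integrable_wilsonWeight hab.1 hab.2.1 hcd.1 hcd.2.1
  constructor
  · rw [← integrableOn_Ioi_comp_rpow_iff _ (two_ne_zero (α := ℝ))]
    exact IntegrableOn.congr_fun (hint.integrableOn.const_mul _) (fun s hs => (hsub s hs).symm) measurableSet_Ioi
  · rw [← integral_comp_rpow_Ioi _ (two_ne_zero (α := ℝ)),
      setIntegral_congr_fun measurableSet_Ioi hsub, integral_const_mul, mul_assoc,
      integral_Ioi_wilsonWeight hab.1 hab.2.1 hcd.1 hcd.2.1]
    have hπ : (Real.pi : ℂ) ≠ 0 := by exact_mod_cast Real.pi_ne_zero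
    field_simp

/-! ### The convolution formula -/

lemma wilsonK_ne_zero {a b c d : ℂ} (ha : 0 < a.re) (hb : 0 < b.re) (hc : 0 < c.re)
    (hd : 0 < d.re) : wilsonK a b c d ≠ 0 := by
  have pos : ∀ {z w : ℂ}, 0 < z.re → 0 < w.re → 0 < (z + w).re := fun {z w} hz hw => by
    rw [Complex.add_re]; exact add_pos hz hw
  have hG : ∀ {z w : ℂ}, 0 < z.re → 0 < w.re → Complex.Gamma (z + w) ≠ 0 := fun hz hw =>
    Complex.Gamma_ne_zero_of_re_pos (pos hz hw)
  have hπ : (Real.pi : ℂ) ≠ 0 := by exact_mod_cast Real.pi_ne_zero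
  exact div_ne_zero (hG (pos (pos ha hb) hc) hd) (mul_ne_zero (mul_ne_zero (mul_ne_zero
    (mul_ne_zero (mul_ne_zero (mul_ne_zero (mul_ne_zero (by norm_num : (4 : ℂ) ≠ 0) hπ) (hG ha hb)) (hG ha hc))
    (hG hb hc)) (hG ha hd)) (hG hb hd)) (hG hc hd))

lemma gammaPair_ne_zero {a : ℂ} (ha : 0 < a.re) (s : ℝ) : gammaPair a (Complex.I * s) ≠ 0 :=
  mul_ne_zero (Complex.Gamma_ne_zero_of_re_pos (by simpa))
    (Complex.Gamma_ne_zero_of_re_pos (by simpa))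

lemma wilsonWeight_ne_zero {a b c d : ℂ} (ha : 0 < a.re) (hb : 0 < b.re) (hc : 0 < c.re)
    (hd : 0 < d.re) {s : ℝ} (hs : 0 < s) : wilsonWeight a b c d s ≠ 0 := by
  have hsh := (Real.sinh_pos_iff.2 (show 0 < 2 * Real.pi * s by positivity)).ne'
  exact mul_ne_zero (mul_ne_zero (mul_ne_zero (mul_ne_zero (gammaPair_ne_zero ha s)
    (gammaPair_ne_zero hb s)) (gammaPair_ne_zero hc s)) (gammaPair_ne_zero hd s))
    (Complex.ofReal_ne_zero.2 (mul_ne_zero hs.ne' hsh))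

lemma wilsonDensity_ne_zero {a b c d : ℂ} (hab : IsAdmissiblePair a b)
    (hcd : IsAdmissiblePair c d) {x : ℝ} (hx : 0 < x) : wilsonDensity x a b c d ≠ 0 := by
  have hsc : ((√x : ℝ) : ℂ) ≠ 0 := by exact_mod_cast (Real.sqrt_pos.2 hx).ne'
  have hπ : (Real.pi : ℂ) ≠ 0 := by exact_mod_cast Real.pi_ne_zero
  rw [wilsonDensity_eq hab hcd hx]
  exact mul_ne_zero (div_ne_zero two_ne_zero (mul_ne_zero hπ hsc))
    (mul_ne_zero (wilsonK_ne_zero hab.1 hab.2.1 hcd.1 hcd.2.1)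
      (wilsonWeight_ne_zero hab.1 hab.2.1 hcd.1 hcd.2.1 (Real.sqrt_pos.2 hx)))

lemma gammaPair_add_mul_gammaPair_sub_comm (m s t : ℂ) :
    gammaPair (m + Complex.I * s) (Complex.I * t) * gammaPair (m - Complex.I * s) (Complex.I * t) =
      gammaPair (m + Complex.I * t) (Complex.I * s) *
        gammaPair (m - Complex.I * t) (Complex.I * s) := by
  simp only [gammaPair]
  rw [show m + Complex.I * t + Complex.I * s = m + Complex.I * s + Complex.I * t by ring,
    show m + Complex.I * t - Complex.I * s = m - Complex.I * s + Complex.I * t by ring,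
    show m - Complex.I * t + Complex.I * s = m + Complex.I * s - Complex.I * t by ring,
    show m - Complex.I * t - Complex.I * s = m - Complex.I * s - Complex.I * t by ring]
  ring

lemma wilsonK_add_sub (a b m s : ℂ) : wilsonK a b (m + Complex.I * s) (m - Complex.I * s) =
    Complex.Gamma (a + b + 2 * m) / (4 * (Real.pi : ℂ) * Complex.Gamma (a + b) *
      gammaPair (a + m) (Complex.I * s) * gammaPair (b + m) (Complex.I * s) *
      Complex.Gamma (2 * m)) := by
  simp only [wilsonK, gammaPair]
  rw [show a + b + (m + Complex.I * s) + (m - Complex.I * s) = a + b + 2 * m by ring,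
    show m + Complex.I * s + (m - Complex.I * s) = 2 * m by ring]
  simp only [add_assoc, add_sub_assoc]
  ring

lemma wilsonK_add_sub_left (c d m s : ℂ) : wilsonK (m + Complex.I * s) (m - Complex.I * s) c d =
    Complex.Gamma (c + d + 2 * m) / (4 * (Real.pi : ℂ) * Complex.Gamma (2 * m) *
      gammaPair (c + m) (Complex.I * s) * gammaPair (d + m) (Complex.I * s) *
      Complex.Gamma (c + d)) := by
  simp only [wilsonK, gammaPair]
  rw [show m + Complex.I * s + (m - Complex.I * s) + c + d = c + d + 2 * m by ring,
    show m + Complex.I * s + (m - Complex.I * s) = 2 * m by ring,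
    show m + Complex.I * s + c = c + m + Complex.I * s by ring,
    show m - Complex.I * s + c = c + m - Complex.I * s by ring,
    show m + Complex.I * s + d = d + m + Complex.I * s by ring,
    show m - Complex.I * s + d = d + m - Complex.I * s by ring]
  ring

/-- Both sides consist of the same Gamma factors; those that involve `x` and `y` together are
exchanged by `gammaPair_add_mul_gammaPair_sub_comm`. -/
lemma wilsonDensity_mul_wilsonDensity {a b c d : ℂ} (hab : IsAdmissiblePair a b)
    (hcd : IsAdmissiblePair c d) {m : ℝ} (hm : 0 < m) {x y : ℝ} (hx : 0 < x) (hy : 0 < y) :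
    wilsonDensity x (a + m) (b + m) c d *
        wilsonDensity y a b (m + Complex.I * (√x : ℝ)) (m - Complex.I * (√x : ℝ)) =
      wilsonDensity x (m + Complex.I * (√y : ℝ)) (m - Complex.I * (√y : ℝ)) c d *
        wilsonDensity y a b (c + m) (d + m) := by
  have pos : ∀ {z w : ℂ}, 0 < z.re → 0 < w.re → 0 < (z + w).re := fun {z w} hz hw => by
    rw [Complex.add_re]; exact add_pos hz hw
  have hG : ∀ {z : ℂ}, 0 < z.re → Complex.Gamma z ≠ 0 := fun hz =>
    Complex.Gamma_ne_zero_of_re_pos hz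
  have ham := hab.add_ofReal hm
  have hcm := hcd.add_ofReal hm
  have h2m : 0 < (2 * m : ℂ).re := by simpa
  rw [wilsonDensity_eq ham hcd hx, wilsonDensity_eq hab (isAdmissiblePair_add_sub hm _) hy,
    wilsonDensity_eq (isAdmissiblePair_add_sub hm _) hcd hx, wilsonDensity_eq hab hcm hy]
  have hcomm := gammaPair_add_mul_gammaPair_sub_comm m (√x : ℝ) (√y : ℝ)
  have n1 := gammaPair_ne_zero ham.1 (√x)
  have n2 := gammaPair_ne_zero ham.2.1 (√x)
  have n3 := gammaPair_ne_zero hcm.1 (√y)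
  have n4 := gammaPair_ne_zero hcm.2.1 (√y)
  have n5 := hG h2m
  have n6 := hG (pos hab.1 hab.2.1)
  have n7 := hG (pos hcd.1 hcd.2.1)
  have n8 := hG (pos (pos hab.1 hab.2.1) h2m)
  have n9 := hG (pos (pos hcd.1 hcd.2.1) h2m)
  have n10 := hG (pos ham.1 hcd.1)
  have n11 := hG (pos ham.2.1 hcd.1)
  have n12 := hG (pos ham.1 hcd.2.1)
  have n13 := hG (pos ham.2.1 hcd.2.1)
  have hπ : (Real.pi : ℂ) ≠ 0 := by exact_mod_cast Real.pi_ne_zero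
  have hK1 : wilsonK (a + m) (b + m) c d = Complex.Gamma (a + b + 2 * m + c + d) /
      (4 * Real.pi * Complex.Gamma (a + b + 2 * m) * Complex.Gamma (a + m + c) *
        Complex.Gamma (b + m + c) * Complex.Gamma (a + m + d) * Complex.Gamma (b + m + d) *
        Complex.Gamma (c + d)) := by
    rw [wilsonK, show a + m + (b + m) = a + b + 2 * m by ring]
  have hK2 : wilsonK a b (c + m) (d + m) = Complex.Gamma (a + b + 2 * m + c + d) /
      (4 * Real.pi * Complex.Gamma (a + b) * Complex.Gamma (a + m + c) *
        Complex.Gamma (b + m + c) * Complex.Gamma (a + m + d) * Complex.Gamma (b + m + d) *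
        Complex.Gamma (c + d + 2 * m)) := by
    rw [wilsonK, show a + b + (c + m) + (d + m) = a + b + 2 * m + c + d by ring,
      show c + m + (d + m) = c + d + 2 * m by ring, show a + (c + m) = a + m + c by ring,
      show b + (c + m) = b + m + c by ring, show a + (d + m) = a + m + d by ring,
      show b + (d + m) = b + m + d by ring]
  rw [wilsonK_add_sub, wilsonK_add_sub_left, hK1, hK2]
  simp only [wilsonWeight]
  generalize gammaPair (a + m) (Complex.I * (√x : ℝ)) = p1 at *
  generalize gammaPair (b + m) (Complex.I * (√x : ℝ)) = p2 at *
  generalize gammaPair (c + m) (Complex.I * (√y : ℝ)) = p3 at *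
  generalize gammaPair (d + m) (Complex.I * (√y : ℝ)) = p4 at *
  generalize gammaPair (m + Complex.I * (√x : ℝ)) (Complex.I * (√y : ℝ)) = p5 at *
  generalize gammaPair (m - Complex.I * (√x : ℝ)) (Complex.I * (√y : ℝ)) = p6 at *
  generalize gammaPair (m + Complex.I * (√y : ℝ)) (Complex.I * (√x : ℝ)) = p7 at *
  generalize gammaPair (m - Complex.I * (√y : ℝ)) (Complex.I * (√x : ℝ)) = p8 at *
  generalize Complex.Gamma (a + b + 2 * m) = g1 at *
  generalize Complex.Gamma (c + d + 2 * m) = g2 at *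
  generalize ((√x * Real.sinh (2 * Real.pi * √x) : ℝ) : ℂ) = S
  generalize ((√y * Real.sinh (2 * Real.pi * √y) : ℝ) : ℂ) = T
  generalize (2 / (Real.pi * (√x : ℝ)) : ℂ) = X
  generalize (2 / (Real.pi * (√y : ℝ)) : ℂ) = Y
  field_simp
  linear_combination (X * Y * S * T * Complex.Gamma (a + b + 2 * m + c + d) *
    gammaPair c (Complex.I * (√x : ℝ)) * gammaPair d (Complex.I * (√x : ℝ)) *
    gammaPair a (Complex.I * (√y : ℝ)) * gammaPair b (Complex.I * (√y : ℝ))) * hcomm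

/-- The rearrangement identity reduces the convolution formula to the fact that
`f(x; m + i√y, m - i√y, c, d)` has total mass one. -/
theorem proposition2p2 (a b c d : ℂ) (hab : IsAdmissiblePair a b) (hcd : IsAdmissiblePair c d)
    (m : ℝ) (hm : 0 < m) :
    -- the convolution formula (the integral converges)
    (∀ y : ℝ, 0 < y →
      MeasureTheory.IntegrableOn
        (fun x : ℝ =>
          wilsonDensity y a b (m + Complex.I * (√x : ℝ)) (m - Complex.I * (√x : ℝ)) *
            wilsonDensity x (a + m) (b + m) c d)
        (Set.Ioi 0) MeasureTheory.volume ∧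
      wilsonDensity y a b (c + m) (d + m) =
        ∫ x in Set.Ioi (0 : ℝ),
          wilsonDensity y a b (m + Complex.I * (√x : ℝ)) (m - Complex.I * (√x : ℝ)) *
            wilsonDensity x (a + m) (b + m) c d) ∧
    -- the rearrangement identity (with nonvanishing denominator)
    (∀ x y : ℝ, 0 < x → 0 < y →
      wilsonDensity y a b (c + m) (d + m) ≠ 0 ∧
      wilsonDensity x (a + m) (b + m) c d *
          wilsonDensity y a b (m + Complex.I * (√x : ℝ)) (m - Complex.I * (√x : ℝ)) /
          wilsonDensity y a b (c + m) (d + m) =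
        wilsonDensity x (m + Complex.I * (√y : ℝ)) (m - Complex.I * (√y : ℝ)) c d) := by
  refine ⟨fun y hy => ?_, fun x y hx hy => ?_⟩
  · obtain ⟨hint, hone⟩ :=
      integrableOn_and_integral_wilsonDensity (isAdmissiblePair_add_sub hm (√y)) hcd
    have hmul : ∀ x ∈ Set.Ioi (0 : ℝ),
        wilsonDensity y a b (m + Complex.I * (√x : ℝ)) (m - Complex.I * (√x : ℝ)) *
          wilsonDensity x (a + m) (b + m) c d =
        wilsonDensity x (m + Complex.I * (√y : ℝ)) (m - Complex.I * (√y : ℝ)) c d *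
          wilsonDensity y a b (c + m) (d + m) := fun x hx => by
      rw [mul_comm, wilsonDensity_mul_wilsonDensity hab hcd hm hx hy]
    refine ⟨IntegrableOn.congr_fun (hint.mul_const _) (fun x hx => (hmul x hx).symm)
      measurableSet_Ioi, ?_⟩
    rw [setIntegral_congr_fun measurableSet_Ioi hmul, integral_mul_const, hone, one_mul]
  · have hne := wilsonDensity_ne_zero hab (hcd.add_ofReal hm) hy
    exact ⟨hne, by rw [wilsonDensity_mul_wilsonDensity hab hcd hm hx hy, mul_div_cancel_right₀ _ hne]⟩
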